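/- Proposition 3.3 (Uniqueness). Let $d\ge 1$, let $\Omega\subset\mathbb R^d$ be a bounded domain, and let $X$ be a closed linear subspace of the real-valued Sobolev space $H^1(\Omega)$, normed by $\|u\|_{H^1}^2=\|u\|_{L^2}^2+\|\nabla u\|_{L^2}^2$; the choice of $X$ encodes the boundary conditions (for instance $X=H^1(\Omega)$, $X=H^1_0(\Omega)$, or periodic functions on a box). Let $1<p<\infty$, and $p<\frac{d+2}{d-2}$ if $d\ge 3$; let $V\in L^\infty(\Omega)$ with $V\ge 0$ a.e. in $\Omega$; and let $\omega>-\lambda_0$, where $$\lambda_0=\inf_{u\in X,\ \|u\|_{L^2}=1}\Big(\tfrac12\|\nabla u\|_{L^2}^2+\int_\Omega V|u|^2\,dx\Big).$$ Put $$Q(u)=\tfrac12\|\nabla u\|_{L^2}^2+\int_\Omega V|u|^2\,dx+\omega\|u\|_{L^2}^2,\qquad G(u)=\tfrac{2}{p+1}\big(\|u\|_{L^{p+1}}^{p+1}-1\big),\qquad L(u,\lambda)=Q(u)-\lambda G(u),$$ and $\mathcal S_{p+1}=\{u\in X:\|u\|_{L^{p+1}}=1\}$. Let $u_g\in\mathcal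 S_{p+1}$ be a minimizer of $Q$ on $\mathcal S_{p+1}$, with Lagrange multiplier $\lambda_g\in\mathbb R$, that is, $$\tfrac12\int_\Omega\nabla u_g\cdot\nabla v\,dx+\int_\Omega (V+\omega)u_g v\,dx=\lambda_g\int_\Omega|u_g|^{p-1}u_g v\,dx\qquad\text{for all } v\in X\cap L^{p+1}(\Omega),$$ and let $\mathcal T_{u_g}=\{\xi\in X\cap L^{p+1}(\Omega):2\int_\Omega|u_g|^{p-1}u_g\,\xi\,dx=0\}$. (Whenever $X$ embeds into $L^{p+1}(\Omega)$, as it does for the boundary conditions above on a sufficiently regular domain, $X\cap L^{p+1}(\Omega)=X$.) Assume that there is a constant $c>0$ such that the second Gâteaux derivative of $L(\cdot,\lambda_g)$ at $u_g$ satisfies $$\mathcal D_u^2L(u_g,\lambda_g)[\xi,\xi]\ \ge\ c\,\|\xi\|_{H^1}^2\qquad\text{for all }\xi\in\mathcal T_{u_g}.$$ Then there exist constants $\delta_0,c_1,c_2>0$ such that for every $\delta\in(0,\delta_0]$, with $U_\delta(u_g)=\{u\in X:\|u-u_g\|_{H^1}\le\delta\}$, $$c_1\|u-u_g\|_{H^1}^2\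 \le\ Q(u)-Q(u_g)\ \le\ c_2\|u-u_g\|_{H^1}^2\qquad\text{for all }u\in U_\delta(u_g)\cap\mathcal S_{p+1}.$$ Moreover $u_g$ is the unique minimizer of $Q$ on $U_\delta(u_g)\cap\mathcal S_{p+1}$, and it is the only minimizer of $Q$ on $\mathcal S_{p+1}$ that lies in $U_\delta(u_g)$. -/

import Mathlib

open MeasureTheory

noncomputable section

namespace ActionGS

/-- Lebesgue measure on `Ω ⊆ ℝ^d`. -/
abbrev leb {d : ℕ} (Ω : Set (EuclideanSpace ℝ (Fin d))) : Measure (EuclideanSpace ℝ (Fin d)) :=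
  volume.restrict Ω

/-- Smooth test functions with compact support inside `Ω`. -/
structure IsTest {d : ℕ} (Ω : Set (EuclideanSpace ℝ (Fin d)))
    (φ : EuclideanSpace ℝ (Fin d) → ℝ) : Prop where
  smooth : ContDiff ℝ (⊤ : ℕ∞) φ
  compact : HasCompactSupport φ
  subset : tsupport φ ⊆ Ω

/-- `g` is the weak gradient of `u` on `Ω`: for every test function `φ` and every `i`,
`∫_Ω u ∂ᵢφ = - ∫_Ω gᵢ φ`. -/
def HasWeakGradient {d : ℕ} (Ω : Set (EuclideanSpace ℝ (Fin d)))
    (u : EuclideanSpace ℝ (Fin d) → ℝ)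
    (g : EuclideanSpace ℝ (Fin d) → EuclideanSpace ℝ (Fin d)) : Prop :=
  ∀ φ : EuclideanSpace ℝ (Fin d) → ℝ, IsTest Ω φ → ∀ i : Fin d,
    ∫ x in Ω, u x * fderiv ℝ φ x (EuclideanSpace.single i 1) = - ∫ x in Ω, g x i * φ x

theorem IsTest.memLp {d : ℕ} {Ω : Set (EuclideanSpace ℝ (Fin d))}
    {φ : EuclideanSpace ℝ (Fin d) → ℝ} (h : IsTest Ω φ) : MemLp φ 2 (leb Ω) :=
  (h.smooth.continuous.memLp_of_hasCompactSupport h.compact).restrict Ω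

theorem IsTest.memLp_fderiv {d : ℕ} {Ω : Set (EuclideanSpace ℝ (Fin d))}
    {φ : EuclideanSpace ℝ (Fin d) → ℝ} (h : IsTest Ω φ) (v : EuclideanSpace ℝ (Fin d)) :
    MemLp (fun x => fderiv ℝ φ x v) 2 (leb Ω) :=
  (((h.smooth.continuous_fderiv (by simp)).clm_apply continuous_const).memLp_of_hasCompactSupport
    (h.compact.fderiv_apply ℝ v)).restrict Ω

theorem memLp_coord {d : ℕ} {Ω : Set (EuclideanSpace ℝ (Fin d))}
    {g : EuclideanSpace ℝ (Fin d) → EuclideanSpace ℝ (Fin d)} (hg : MemLp g 2 (leb Ω))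
    (i : Fin d) : MemLp (fun x => g x i) 2 (leb Ω) :=
  (EuclideanSpace.proj i : EuclideanSpace ℝ (Fin d) →L[ℝ] ℝ).comp_memLp' hg

theorem integrable_fn_mul {d : ℕ} {Ω : Set (EuclideanSpace ℝ (Fin d))}
    {φ : EuclideanSpace ℝ (Fin d) → ℝ} (hφ : IsTest Ω φ) (u : Lp ℝ 2 (leb Ω))
    (v : EuclideanSpace ℝ (Fin d)) :
    Integrable (fun x => u x * fderiv ℝ φ x v) (leb Ω) :=
  (Lp.memLp u).integrable_mul (hφ.memLp_fderiv v)

theorem integrable_coord_mul {d : ℕ} {Ω : Set (EuclideanSpace ℝ (Fin d))}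
    {φ : EuclideanSpace ℝ (Fin d) → ℝ} (hφ : IsTest Ω φ)
    (g : Lp (EuclideanSpace ℝ (Fin d)) 2 (leb Ω)) (i : Fin d) :
    Integrable (fun x => g x i * φ x) (leb Ω) :=
  (memLp_coord (Lp.memLp g) i).integrable_mul hφ.memLp

/-- The Sobolev space `H¹(Ω)` of real-valued functions, realised as the space of pairs `(u, ∇u)`
with `u ∈ L²(Ω)` whose weak gradient `∇u` is in `L²(Ω)`. As a subspace of the `ℓ²`-product it
carries the norm `‖u‖_{H¹}² = ‖u‖_{L²}² + ‖∇u‖_{L²}²`. -/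
def H1 {d : ℕ} (Ω : Set (EuclideanSpace ℝ (Fin d))) :
    Submodule ℝ (WithLp 2 (Lp ℝ 2 (leb Ω) × Lp (EuclideanSpace ℝ (Fin d)) 2 (leb Ω))) where
  carrier := {w | HasWeakGradient Ω w.fst w.snd}
  zero_mem' := by
    intro φ hφ i
    have h1 : ∫ x in Ω, (0 : Lp ℝ 2 (leb Ω)) x * fderiv ℝ φ x (EuclideanSpace.single i 1) = 0 := by
      refine integral_eq_zero_of_ae ?_
      filter_upwards [Lp.coeFn_zero ℝ 2 (leb Ω)] with x hx
      rw [hx]; simp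
    have h2 : ∫ x in Ω, (0 : Lp (EuclideanSpace ℝ (Fin d)) 2 (leb Ω)) x i * φ x = 0 := by
      refine integral_eq_zero_of_ae ?_
      filter_upwards [Lp.coeFn_zero (EuclideanSpace ℝ (Fin d)) 2 (leb Ω)] with x hx
      rw [hx]; simp
    exact h1.trans (by rw [← neg_zero, ← h2]; rfl)
  add_mem' := by
    intro a b ha hb φ hφ i
    have h1 : ∫ x in Ω, (a.fst + b.fst) x * fderiv ℝ φ x (EuclideanSpace.single i 1)
        = (∫ x in Ω, a.fst x * fderiv ℝ φ x (EuclideanSpace.single i 1))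
          + ∫ x in Ω, b.fst x * fderiv ℝ φ x (EuclideanSpace.single i 1) := by
      rw [← integral_add (integrable_fn_mul hφ a.fst _) (integrable_fn_mul hφ b.fst _)]
      refine integral_congr_ae ?_
      filter_upwards [Lp.coeFn_add a.fst b.fst] with x hx
      rw [hx]; simp [add_mul]
    have h2 : ∫ x in Ω, (a.snd + b.snd) x i * φ x
        = (∫ x in Ω, a.snd x i * φ x) + ∫ x in Ω, b.snd x i * φ x := by
      rw [← integral_add (integrable_coord_mul hφ a.snd i) (integrable_coord_mul hφ b.snd i)]
      refine integral_congr_ae ?_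
      filter_upwards [Lp.coeFn_add a.snd b.snd] with x hx
      rw [hx]; simp [add_mul]
    have h3 := ha φ hφ i
    have h4 := hb φ hφ i
    simp only [WithLp.add_fst, WithLp.add_snd]
    rw [h1, h2, h3, h4]
    ring
  smul_mem' := by
    intro c a ha φ hφ i
    have h1 : ∫ x in Ω, (c • a.fst) x * fderiv ℝ φ x (EuclideanSpace.single i 1)
        = c * ∫ x in Ω, a.fst x * fderiv ℝ φ x (EuclideanSpace.single i 1) := by
      rw [← integral_const_mul]
      refine integral_congr_ae ?_
      filter_upwards [Lp.coeFn_smul c a.fst] with x hx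
      rw [hx]; simp [mul_assoc]
    have h2 : ∫ x in Ω, (c • a.snd) x i * φ x = c * ∫ x in Ω, a.snd x i * φ x := by
      rw [← integral_const_mul]
      refine integral_congr_ae ?_
      filter_upwards [Lp.coeFn_smul c a.snd] with x hx
      rw [hx]; simp [mul_assoc]
    have h3 := ha φ hφ i
    simp only [WithLp.smul_fst, WithLp.smul_snd]
    rw [h1, h2, h3]
    ring

/-- The function underlying an element of `H¹(Ω)`, as an element of `L²(Ω)`. -/
def fn {d : ℕ} {Ω : Set (EuclideanSpace ℝ (Fin d))} (u : H1 Ω) : Lp ℝ 2 (leb Ω) :=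
  (u : WithLp 2 (Lp ℝ 2 (leb Ω) × Lp (EuclideanSpace ℝ (Fin d)) 2 (leb Ω))).fst

/-- The weak gradient of an element of `H¹(Ω)`. -/
def grad {d : ℕ} {Ω : Set (EuclideanSpace ℝ (Fin d))} (u : H1 Ω) :
    Lp (EuclideanSpace ℝ (Fin d)) 2 (leb Ω) :=
  (u : WithLp 2 (Lp ℝ 2 (leb Ω) × Lp (EuclideanSpace ℝ (Fin d)) 2 (leb Ω))).snd

theorem norm_sq_eq {d : ℕ} {Ω : Set (EuclideanSpace ℝ (Fin d))} (u : H1 Ω) :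
    ‖u‖ ^ 2 = ‖fn u‖ ^ 2 + ‖grad u‖ ^ 2 :=
  WithLp.prod_norm_sq_eq_of_L2 _

/-- An element of `H¹(Ω)` is determined by its underlying function. -/
theorem fn_injective {d : ℕ} {Ω : Set (EuclideanSpace ℝ (Fin d))} (hΩ : IsOpen Ω) :
    Function.Injective (fn : H1 Ω → Lp ℝ 2 (leb Ω)) := by
  intro u v huv
  have key : ∀ i : Fin d, ∀ᵐ x ∂(volume : Measure (EuclideanSpace ℝ (Fin d))), x ∈ Ω →
      grad u x i - grad v x i = 0 := by
    intro i
    have hL : MemLp (fun x => grad u x i - grad v x i) 2 (leb Ω) :=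
      (memLp_coord (Lp.memLp (grad u)) i).sub (memLp_coord (Lp.memLp (grad v)) i)
    refine hΩ.ae_eq_zero_of_integral_contDiff_smul_eq_zero ?_ ?_
    · have h1 : LocallyIntegrable (fun x => grad u x i - grad v x i) (leb Ω) :=
        hL.locallyIntegrable (by norm_num)
      intro x hx
      obtain ⟨K, hK, hKΩ, hKc⟩ := local_compact_nhds (hΩ.mem_nhds hx)
      refine ⟨K, mem_nhdsWithin_of_mem_nhds hK, ?_⟩
      have h2 := h1.integrableOn_isCompact hKc
      rw [IntegrableOn, Measure.restrict_restrict hKc.measurableSet,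
        Set.inter_eq_left.2 hKΩ] at h2
      exact h2
    · intro φ h1 h2 h3
      have hφ : IsTest Ω φ := ⟨h1, h2, h3⟩
      have hu := u.2 φ hφ i
      have hv := v.2 φ hφ i
      have e1 : ∫ x in Ω, grad u x i * φ x = ∫ x in Ω, grad v x i * φ x := by
        have h5 := hu.symm.trans ((by
          change ∫ x in Ω, fn u x * _ = ∫ x in Ω, fn v x * _
          rw [huv]) : _ = _) |>.trans hv
        exact neg_injective h5
      have e2 : ∫ x in Ω, φ x • (grad u x i - grad v x i) = 0 := by
        have : ∀ x, φ x • (grad u x i - grad v x i) = grad u x i * φ x - grad v x i * φ x := by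
          intro x; simp only [smul_eq_mul]; ring
        simp only [this]
        rw [integral_sub (integrable_coord_mul hφ (grad u) i) (integrable_coord_mul hφ (grad v) i), e1, sub_self]
      rw [← setIntegral_eq_integral_of_forall_compl_eq_zero (s := Ω)]
      · exact e2
      · intro x hx
        rw [image_eq_zero_of_notMem_tsupport (fun h => hx (h3 h)), zero_smul]
  have hg : grad u = grad v := by
    refine Lp.ext ?_
    have := (ae_restrict_iff' hΩ.measurableSet (μ := volume)
      (p := fun x => ∀ i, grad u x i - grad v x i = 0)).2 (by
        filter_upwards [ae_all_iff.2 key] with x hx hxΩ i using hx i hxΩ)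
    filter_upwards [this] with x hx
    ext i
    exact sub_eq_zero.1 (hx i)
  apply Subtype.ext
  exact (WithLp.ofLp_injective 2) (Prod.ext huv hg)

/-- `Q(u) = ½ ‖∇u‖²_{L²} + ∫_Ω V |u|² + ω ‖u‖²_{L²}`. -/
def Q {d : ℕ} {Ω : Set (EuclideanSpace ℝ (Fin d))} (V : EuclideanSpace ℝ (Fin d) → ℝ) (ω : ℝ)
    (u : H1 Ω) : ℝ :=
  1 / 2 * ‖grad u‖ ^ 2 + (∫ x in Ω, V x * |fn u x| ^ 2) + ω * ‖fn u‖ ^ 2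

/-- `λ₀ = inf { ½ ‖∇u‖²_{L²} + ∫_Ω V |u|² : u ∈ X, ‖u‖_{L²} = 1 }`. -/
def lambda0 {d : ℕ} {Ω : Set (EuclideanSpace ℝ (Fin d))} (X : Submodule ℝ (H1 Ω))
    (V : EuclideanSpace ℝ (Fin d) → ℝ) : ℝ :=
  sInf {e : ℝ | ∃ u ∈ X, ‖fn u‖ = 1 ∧
    e = 1 / 2 * ‖grad u‖ ^ 2 + ∫ x in Ω, V x * |fn u x| ^ 2}

/-- `‖u‖_{L^{p+1}(Ω)}`, in `[0, ∞]`. -/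
def normLp1 {d : ℕ} {Ω : Set (EuclideanSpace ℝ (Fin d))} (p : ℝ) (u : H1 Ω) : ENNReal :=
  eLpNorm (fn u) (ENNReal.ofReal (p + 1)) (leb Ω)

/-- The sphere `𝒮_{p+1} = {u ∈ X : ‖u‖_{L^{p+1}} = 1}`. -/
def sphere {d : ℕ} {Ω : Set (EuclideanSpace ℝ (Fin d))} (X : Submodule ℝ (H1 Ω)) (p : ℝ) :
    Set (H1 Ω) :=
  {u | u ∈ X ∧ normLp1 p u = 1}

/-- `u` is a ground state: a minimizer of `Q` on `𝒮_{p+1}`. -/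
def IsGroundState {d : ℕ} {Ω : Set (EuclideanSpace ℝ (Fin d))} (X : Submodule ℝ (H1 Ω))
    (V : EuclideanSpace ℝ (Fin d) → ℝ) (ω p : ℝ) (u : H1 Ω) : Prop :=
  u ∈ sphere X p ∧ IsMinOn (Q V ω) (sphere X p) u

/-- The constraint functional `G(u) = 2/(p+1) (‖u‖_{L^{p+1}}^{p+1} - 1)` (of interest only for
`u ∈ L^{p+1}(Ω)`). -/
def G {d : ℕ} {Ω : Set (EuclideanSpace ℝ (Fin d))} (p : ℝ) (u : H1 Ω) : ℝ :=
  2 / (p + 1) * ((normLp1 p u).toReal ^ (p + 1) - 1)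

/-- The Lagrangian `L(u, l) = Q(u) - l G(u)`. -/
def Lagrangian {d : ℕ} {Ω : Set (EuclideanSpace ℝ (Fin d))}
    (V : EuclideanSpace ℝ (Fin d) → ℝ) (ω p l : ℝ) (u : H1 Ω) : ℝ :=
  Q V ω u - l * G p u

/-- The pairing `⟨|u|^{p-1} u, v⟩ = ∫_Ω |u|^{p-1} u v`. -/
def pairing {d : ℕ} {Ω : Set (EuclideanSpace ℝ (Fin d))} (p : ℝ) (u v : H1 Ω) : ℝ :=
  ∫ x in Ω, |fn u x| ^ (p - 1) * fn u x * fn v x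

/-- The tangent space `𝒯_u = {ξ ∈ X : 2 ⟨|u|^{p-1} u, ξ⟩ = 0}`. Finiteness of `‖ξ‖_{L^{p+1}}`, which
makes the pairing meaningful, is automatic whenever `X` embeds into `L^{p+1}(Ω)`. -/
def tangent {d : ℕ} {Ω : Set (EuclideanSpace ℝ (Fin d))} (X : Submodule ℝ (H1 Ω)) (p : ℝ)
    (u : H1 Ω) : Set (H1 Ω) :=
  {ξ | ξ ∈ X ∧ normLp1 p ξ < ⊤ ∧ 2 * pairing p u ξ = 0}

/-- `l` is the Lagrange multiplier of `u`: `(-½Δ + V + ω) u = l |u|^{p-1} u` weakly, tested with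
all `v ∈ X` (the bound on `‖v‖_{L^{p+1}}` is again automatic whenever `X` embeds into
`L^{p+1}(Ω)`). -/
def IsMultiplier {d : ℕ} {Ω : Set (EuclideanSpace ℝ (Fin d))} (X : Submodule ℝ (H1 Ω))
    (V : EuclideanSpace ℝ (Fin d) → ℝ) (ω p : ℝ) (u : H1 Ω) (l : ℝ) : Prop :=
  ∀ v ∈ X, normLp1 p v < ⊤ →
    1 / 2 * inner ℝ (grad u) (grad v) + ∫ x in Ω, (V x + ω) * fn u x * fn v x
      = l * pairing p u v

/-- The Gâteaux derivative `𝒟F(u)[v]`. -/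
def gateaux {E : Type*} [AddCommGroup E] [Module ℝ E] (F : E → ℝ) (u v : E) : ℝ :=
  deriv (fun t : ℝ => F (u + t • v)) 0

/-- The second Gâteaux derivative `𝒟²F(u)[w, v]`. -/
def gateaux2 {E : Type*} [AddCommGroup E] [Module ℝ E] (F : E → ℝ) (u w v : E) : ℝ :=
  deriv (fun s : ℝ => gateaux F (u + s • w) v) 0

/-- The neighbourhood `U_δ(u) = {w ∈ X : ‖w - u‖_{H¹} ≤ δ}`. -/
def nbhd {d : ℕ} {Ω : Set (EuclideanSpace ℝ (Fin d))} (X : Submodule ℝ (H1 Ω)) (u : H1 Ω)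
    (δ : ℝ) : Set (H1 Ω) :=
  {w | w ∈ X ∧ ‖w - u‖ ≤ δ}

end ActionGS

end

noncomputable section

namespace ActionGS

/-! ### Scalar calculus of `|x|^(p+1)`: derivatives, convexity, second-order Taylor bound. -/

section Scalar

/-! Write `u = u_g + h`, `r = ‖h‖`, `l = λ_g`, `a = ∫ |u_g|^(p-1) u_g h`, `A = ∫ |u_g|^(p-1) h²`, `P
= ∫ |h|^(p+1)`. Since `Q` is a quadratic form, the multiplier equation gives the exact identity
`Q(u) - Q(u_g) = 2la + Q(h)`. Testing that equation with `u_g` gives `l = Q(u_g)`, which is positive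
by the frequency condition.

The linear term is controlled by the constraint, as `u` and `u_g` both have `L^(p+1)` norm one.
Convexity of `|x|^(p+1)` forces `a ≤ 0`, so the upper bound is just `Q(h) ≤ C r²`. The Taylor
estimate `abs_add_rpow_le` gives, conversely, `2la ≥ -lpA` up to a small multiple of `A` and a
multiple of `P`.

Coercivity holds only on the tangent space, so `le_Q_of_coercive` splits off the `u_g` component of
`h` and obtains `Q(h) ≥ (c/4) r² + lpA - m a²`. The terms `lpA` cancel. The remaining errors are
small against `r²`, because `A = O(r²)`, `P = O(r^(p+1))` and hence `a = O(r²)`;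
`second_order_lower_bound` does this accounting. The required control of the `L^(p+1)` norm by the
`H¹` norm comes from minimality of `u_g` and homogeneity, in `exists_integral_rpow_le`.

A quadratic lower bound with positive constant excludes any other point of the neighbourhood on the
sphere with energy at most `Q(u_g)`, which is both uniqueness claims. -/

theorem rpow_sub_one_mul_self {p x : ℝ} (hp : 0 < p) (hx : 0 ≤ x) : x ^ (p - 1) * x = x ^ p := by
  rw [← Real.rpow_add_one' hx (by linarith)]; congr 1; ring

theorem rpow_sub_one_mul_sq {p x : ℝ} (hp : 1 < p) (hx : 0 ≤ x) :
    x ^ (p - 1) * x ^ 2 = x ^ (p + 1) := by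
  rw [pow_two, ← mul_assoc, rpow_sub_one_mul_self (by linarith) hx,
    Real.rpow_add_one' hx (by linarith)]

theorem hasDerivAt_abs_rpow_add_one {p : ℝ} (hp : 1 < p) (x : ℝ) :
    HasDerivAt (fun y : ℝ => |y| ^ (p + 1)) ((p + 1) * (|x| ^ (p - 1) * x)) x := by
  have h := hasDerivAt_abs_rpow x (p := p + 1) (by linarith)
  rwa [show p + 1 - 2 = p - 1 by ring, mul_assoc] at h

/-- Away from zero this is the product rule. At zero, where `|y|` is not differentiable, the slope
is `|y|^(p-1)`, which tends to `0` because `p > 1`. -/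
theorem hasDerivAt_abs_rpow_mul_self {p : ℝ} (hp : 1 < p) (x : ℝ) :
    HasDerivAt (fun y : ℝ => |y| ^ (p - 1) * y) (p * |x| ^ (p - 1)) x := by
  rcases eq_or_ne x 0 with rfl | hx
  · have h0 : |(0 : ℝ)| ^ (p - 1) = 0 := by
      rw [abs_zero, Real.zero_rpow (by linarith)]
    have hc : Continuous fun y : ℝ => |y| ^ (p - 1) :=
      continuous_abs.rpow_const fun _ => Or.inr (by linarith)
    rw [hasDerivAt_iff_tendsto_slope, h0, mul_zero]
    have ht := (hc.tendsto 0).mono_left (nhdsWithin_le_nhds (s := {(0 : ℝ)}ᶜ))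
    rw [h0] at ht
    refine ht.congr' ?_
    filter_upwards [self_mem_nhdsWithin] with y hy
    have hy' : y ≠ 0 := hy
    simp [slope_def_field, hy']
  · have hpos : 0 < |x| := abs_pos.2 hx
    have h := ((hasDerivAt_abs hx).rpow_const (p := p - 1) (Or.inl hpos.ne')).mul (hasDerivAt_id x)
    refine h.congr_deriv ?_
    have h1 : ((SignType.sign x : SignType) : ℝ) * x = |x| := sign_mul_self x
    have h2 : |x| ^ (p - 1 - 1) * |x| = |x| ^ (p - 1) := by
      rw [← Real.rpow_add_one hpos.ne']; congr 1; ring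
    simp only [id]
    linear_combination (p - 1) * |x| ^ (p - 1 - 1) * h1 + (p - 1) * h2

/-- First order convexity inequality for `x ↦ |x|^(p+1)`. -/
theorem abs_rpow_add_ge {p : ℝ} (hp : 1 < p) (a b : ℝ) :
    |a| ^ (p + 1) + (p + 1) * (|a| ^ (p - 1) * a * b) ≤ |a + b| ^ (p + 1) := by
  rcases eq_or_ne a 0 with rfl | ha
  · rw [abs_zero, Real.zero_rpow (by linarith)]
    simp only [mul_zero, zero_mul, add_zero]
    positivity
  -- Dividing by `|a|^(p+1)` reduces to Bernoulli's inequality; for `b / a < -1` the left side is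
  -- negative.
  · have key : 1 + (p + 1) * (b / a) ≤ |1 + b / a| ^ (p + 1) := by
      by_cases hb : -1 ≤ b / a
      · rw [abs_of_nonneg (by linarith)]
        exact one_add_mul_self_le_rpow_one_add hb (by linarith)
      · have : 0 ≤ |1 + b / a| ^ (p + 1) := by positivity
        nlinarith
    have hab : a + b = a * (1 + b / a) := by field_simp
    have h2 := mul_le_mul_of_nonneg_left key (show 0 ≤ |a| ^ (p + 1) by positivity)
    rw [← Real.mul_rpow (abs_nonneg _) (abs_nonneg _), ← abs_mul, ← hab] at h2
    refine le_trans (le_of_eq ?_) h2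
    rw [← rpow_sub_one_mul_sq hp (abs_nonneg a), sq_abs]
    field_simp

/-- Second order Taylor estimate for `t ↦ |1 + t|^(p+1)`. -/
theorem abs_one_add_rpow_le {p : ℝ} (hp : 1 < p) {ε : ℝ} (hε : 0 < ε) :
    ∃ C > 0, ∀ t : ℝ, |1 + t| ^ (p + 1) ≤
      1 + (p + 1) * t + ((p + 1) * p / 2 + ε) * t ^ 2 + C * |t| ^ (p + 1) := by
  -- The remainder has derivative `p + 1` times the linearisation error of `|y|^(p-1) y` at `1`;
  -- this tolerance makes that product at most `ε |t|`.
  have hε' : 0 < ε / (p + 1) := by positivity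
  have hd := (hasDerivAt_iff_isLittleO.1 (hasDerivAt_abs_rpow_mul_self hp 1)).def hε'
  obtain ⟨η₀, hη₀, hη⟩ := Metric.eventually_nhds_iff.1 hd
  set η := η₀ / 2 with hηd
  have hηpos : 0 < η := by positivity
  have hloc : ∀ t : ℝ, |t| ≤ η → |(|1 + t| ^ (p - 1) * (1 + t)) - 1 - p * t| ≤
      ε / (p + 1) * |t| := by
    intro t ht
    have := hη (y := 1 + t) (by rw [Real.dist_eq]; simp; linarith)
    simp at this
    rwa [mul_comm t p] at this
  -- For `|t| > η`, with `r = |t| / η ≥ 1`, both `|1 + t|^(p+1)` and `-(p+1) t` are bounded by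
  -- multiples of `r^(p+1)`; `D` collects the two factors and a spare `1`.
  set D : ℝ := (1 + η) ^ (p + 1) + 1 + (p + 1) * η with hD
  have hDpos : 0 < D := by positivity
  refine ⟨D / η ^ (p + 1), by positivity, fun t => ?_⟩
  by_cases ht : |t| ≤ η
  · have hderiv : ∀ x ∈ Set.uIcc 0 t, HasDerivWithinAt
        (fun y => |1 + y| ^ (p + 1) - 1 - (p + 1) * y - (p + 1) * p / 2 * y ^ 2)
        ((p + 1) * ((|1 + x| ^ (p - 1) * (1 + x)) - 1 - p * x)) (Set.uIcc 0 t) x := by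
      intro x _
      have h1 := (hasDerivAt_abs_rpow_add_one hp (1 + x)).comp_const_add 1 x
      have h2 := ((h1.sub_const 1).sub ((hasDerivAt_id x).const_mul (p + 1))).sub
        ((hasDerivAt_pow 2 x).const_mul ((p + 1) * p / 2))
      refine (h2.congr_deriv ?_).hasDerivWithinAt
      push_cast
      ring
    have hbound : ∀ x ∈ Set.uIcc 0 t,
        ‖(p + 1) * ((|1 + x| ^ (p - 1) * (1 + x)) - 1 - p * x)‖ ≤ ε * |t| := by
      intro x hx
      have hxt : |x| ≤ |t| := by
        have := Set.abs_sub_left_of_mem_uIcc hx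
        simpa using this
      have := hloc x (hxt.trans ht)
      rw [Real.norm_eq_abs, abs_mul, abs_of_pos (by linarith : 0 < p + 1)]
      calc (p + 1) * |(|1 + x| ^ (p - 1) * (1 + x)) - 1 - p * x|
          ≤ (p + 1) * (ε / (p + 1) * |x|) := by gcongr
        _ = ε * |x| := by field_simp
        _ ≤ ε * |t| := by gcongr
    have hmv := Convex.norm_image_sub_le_of_norm_hasDerivWithin_le hderiv hbound
      (convex_uIcc 0 t) Set.left_mem_uIcc Set.right_mem_uIcc
    simp only [add_zero, abs_one, Real.one_rpow, sub_zero, mul_zero, sub_self, ne_eq,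
      OfNat.ofNat_ne_zero, not_false_eq_true, zero_pow, Real.norm_eq_abs] at hmv
    have h3 := (abs_le.1 hmv).2
    have h4 : ε * |t| * |t| = ε * t ^ 2 := by rw [mul_assoc, ← pow_two, sq_abs]
    have h5 : 0 ≤ D / η ^ (p + 1) * |t| ^ (p + 1) := by positivity
    nlinarith
  · push Not at ht
    set r := |t| / η with hr
    have hr1 : 1 ≤ r := by rw [hr, le_div_iff₀ hηpos]; linarith
    have htr : |t| = η * r := by rw [hr]; field_simp
    have hrp : r ≤ r ^ (p + 1) := by
      simpa using Real.rpow_le_rpow_of_exponent_le hr1 (by linarith : (1 : ℝ) ≤ p + 1)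
    have h1 : |1 + t| ^ (p + 1) ≤ (1 + η) ^ (p + 1) * r ^ (p + 1) := by
      rw [← Real.mul_rpow (by positivity) (by positivity)]
      refine Real.rpow_le_rpow (abs_nonneg _) ?_ (by linarith)
      have := abs_add_le 1 t
      rw [abs_one, htr] at this
      nlinarith
    have h2 : D / η ^ (p + 1) * |t| ^ (p + 1) = D * r ^ (p + 1) := by
      rw [hr, Real.div_rpow (abs_nonneg _) hηpos.le]; ring
    have h3 : -(p + 1) * t ≤ (p + 1) * η * r ^ (p + 1) := by
      have := neg_abs_le t
      rw [htr] at this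
      have h6 : η * r ≤ η * r ^ (p + 1) := by gcongr
      nlinarith
    have h4 : 0 ≤ ((p + 1) * p / 2 + ε) * t ^ 2 := by positivity
    rw [h2, hD]
    nlinarith

/-- Homogeneity reduces to `t = b / a`, and makes the constant uniform in `a`. -/
theorem abs_add_rpow_le {p : ℝ} (hp : 1 < p) {ε : ℝ} (hε : 0 < ε) :
    ∃ C > 0, ∀ a b : ℝ, |a + b| ^ (p + 1) ≤
      |a| ^ (p + 1) + (p + 1) * (|a| ^ (p - 1) * a * b)
        + ((p + 1) * p / 2 + ε) * (|a| ^ (p - 1) * b ^ 2) + C * |b| ^ (p + 1) := by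
  obtain ⟨C, hC, h⟩ := abs_one_add_rpow_le hp hε
  -- The case `a = 0` needs a constant of at least `1`.
  refine ⟨max C 1, by positivity, fun a b => ?_⟩
  rcases eq_or_ne a 0 with rfl | ha
  · have h1 : |b| ^ (p + 1) ≤ max C 1 * |b| ^ (p + 1) :=
      le_mul_of_one_le_left (by positivity) (le_max_right _ _)
    simpa [Real.zero_rpow (by linarith : p + 1 ≠ 0), Real.zero_rpow (by linarith : p - 1 ≠ 0)]
      using h1
  · have hab : a + b = a * (1 + b / a) := by field_simp
    have h2 := mul_le_mul_of_nonneg_left (h (b / a)) (show 0 ≤ |a| ^ (p + 1) by positivity)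
    rw [← Real.mul_rpow (abs_nonneg _) (abs_nonneg _), ← abs_mul, ← hab] at h2
    refine h2.trans ?_
    have h3 : |a| ^ (p + 1) * |b / a| ^ (p + 1) = |b| ^ (p + 1) := by
      rw [← Real.mul_rpow (abs_nonneg _) (abs_nonneg _), ← abs_mul]; congr 2; field_simp
    have h4 : |a| ^ (p + 1) = |a| ^ (p - 1) * a ^ 2 := by
      rw [← rpow_sub_one_mul_sq hp (abs_nonneg a), sq_abs]
    have h5 : C * |b| ^ (p + 1) ≤ max C 1 * |b| ^ (p + 1) := by gcongr; exact le_max_left _ _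
    calc |a| ^ (p + 1) * (1 + (p + 1) * (b / a) + ((p + 1) * p / 2 + ε) * (b / a) ^ 2
          + C * |b / a| ^ (p + 1))
        = |a| ^ (p + 1) + (p + 1) * (|a| ^ (p + 1) * (b / a))
          + ((p + 1) * p / 2 + ε) * (|a| ^ (p + 1) * (b / a) ^ 2)
          + C * (|a| ^ (p + 1) * |b / a| ^ (p + 1)) := by ring
      _ = |a| ^ (p + 1) + (p + 1) * (|a| ^ (p - 1) * a * b)
          + ((p + 1) * p / 2 + ε) * (|a| ^ (p - 1) * b ^ 2) + C * |b| ^ (p + 1) := by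
        rw [h3, show |a| ^ (p + 1) * (b / a) = |a| ^ (p - 1) * a * b by rw [h4]; field_simp,
          show |a| ^ (p + 1) * (b / a) ^ 2 = |a| ^ (p - 1) * b ^ 2 by rw [h4]; field_simp]
      _ ≤ _ := by linarith

end Scalar

/-! ### Integrability in `L^(p+1)` and differentiation under the integral. -/

section Integrals

variable {α : Type*} [MeasurableSpace α] {μ : Measure α} {p : ℝ} {f g : α → ℝ}

theorem integrable_abs_rpow (hp : 1 < p) (hf : MemLp f (ENNReal.ofReal (p + 1)) μ) :
    Integrable (fun x => |f x| ^ (p + 1)) μ := by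
  have h := hf.integrable_norm_rpow (by simp; linarith) ENNReal.ofReal_ne_top
  rwa [ENNReal.toReal_ofReal (by linarith)] at h

theorem aestronglyMeasurable_abs_rpow {r : ℝ} (hr : 0 ≤ r) (hf : AEStronglyMeasurable f μ) :
    AEStronglyMeasurable (fun x => |f x| ^ r) μ :=
  (continuous_abs.rpow_const fun _ => Or.inr hr).comp_aestronglyMeasurable hf

/-- A common majorant: `c = 1` serves for the mixed products of `f` and `g`, and `c = |t₀| + 1` for
the `t`-derivatives when `|t - t₀| < 1`. -/
theorem integrable_abs_add_rpow (hp : 1 < p) (hf : MemLp f (ENNReal.ofReal (p + 1)) μ)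
    (hg : MemLp g (ENNReal.ofReal (p + 1)) μ) (c : ℝ) :
    Integrable (fun x => |(|f x| + c * |g x|)| ^ (p + 1)) μ :=
  integrable_abs_rpow hp (hf.abs.add (hg.abs.const_mul c))

theorem integrable_abs_rpow_mul_mul (hp : 1 < p) (hf : MemLp f (ENNReal.ofReal (p + 1)) μ)
    (hg : MemLp g (ENNReal.ofReal (p + 1)) μ) :
    Integrable (fun x => |f x| ^ (p - 1) * f x * g x) μ := by
  refine (integrable_abs_add_rpow hp hf hg 1).mono'
    (((aestronglyMeasurable_abs_rpow (by linarith) hf.1).mul hf.1).mul hg.1) (ae_of_all _ fun x => ?_)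
  have hf0 := abs_nonneg (f x)
  have hg0 := abs_nonneg (g x)
  rw [one_mul, abs_of_nonneg (by positivity : 0 ≤ |f x| + |g x|), norm_mul, norm_mul,
    Real.norm_of_nonneg (by positivity : 0 ≤ |f x| ^ (p - 1)), Real.norm_eq_abs, Real.norm_eq_abs,
    ← rpow_sub_one_mul_sq hp (by positivity : 0 ≤ |f x| + |g x|), pow_two, mul_assoc]
  gcongr <;> linarith

theorem integrable_abs_rpow_mul_sq (hp : 1 < p) (hf : MemLp f (ENNReal.ofReal (p + 1)) μ)
    (hg : MemLp g (ENNReal.ofReal (p + 1)) μ) :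
    Integrable (fun x => |f x| ^ (p - 1) * g x ^ 2) μ := by
  refine (integrable_abs_add_rpow hp hf hg 1).mono'
    ((aestronglyMeasurable_abs_rpow (by linarith) hf.1).mul (hg.1.pow 2)) (ae_of_all _ fun x => ?_)
  have hf0 := abs_nonneg (f x)
  have hg0 := abs_nonneg (g x)
  rw [one_mul, abs_of_nonneg (by positivity : 0 ≤ |f x| + |g x|),
    Real.norm_of_nonneg (by positivity),
    ← rpow_sub_one_mul_sq hp (by positivity : 0 ≤ |f x| + |g x|), ← sq_abs (g x)]
  gcongr <;> linarith

/-- If `‖f‖_{p+1} ≤ 1` and `‖g‖_{p+1} ≤ M`, then `∫ |f|^{p-1} g² ≤ 2 M²`. -/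
theorem integral_abs_rpow_mul_sq_le (hp : 1 < p) (hf : MemLp f (ENNReal.ofReal (p + 1)) μ)
    (hg : MemLp g (ENNReal.ofReal (p + 1)) μ) (hf1 : ∫ x, |f x| ^ (p + 1) ∂μ ≤ 1)
    {M : ℝ} (hM : 0 < M) (hgM : ∫ x, |g x| ^ (p + 1) ∂μ ≤ M ^ (p + 1)) :
    ∫ x, |f x| ^ (p - 1) * g x ^ 2 ∂μ ≤ 2 * M ^ 2 := by
  have hMp : 0 < M ^ (p + 1) := by positivity
  have hpt : ∀ x, |f x| ^ (p - 1) * g x ^ 2 ≤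
      M ^ 2 * (|f x| ^ (p + 1) + (M ^ (p + 1))⁻¹ * |g x| ^ (p + 1)) := by
    intro x
    set a := |f x|
    set b := |g x| / M with hb
    have ha0 : 0 ≤ a := abs_nonneg _
    have hb0 : 0 ≤ b := by positivity
    have hgb : g x ^ 2 = M ^ 2 * b ^ 2 := by rw [← sq_abs, hb]; field_simp
    have hgb' : (M ^ (p + 1))⁻¹ * |g x| ^ (p + 1) = b ^ (p + 1) := by
      rw [hb, Real.div_rpow (abs_nonneg _) hM.le]; ring
    -- The product is at most `max a b ^ (p + 1)`. Scaling `g` by `M` beforehand makes both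
    -- integrals at most one, hence the factor `2`.
    have key : a ^ (p - 1) * b ^ 2 ≤ a ^ (p + 1) + b ^ (p + 1) := by
      have h1 : 0 ≤ a ^ (p + 1) := by positivity
      have h2 : 0 ≤ b ^ (p + 1) := by positivity
      rcases le_total a b with hab | hab
      · have : a ^ (p - 1) * b ^ 2 ≤ b ^ (p - 1) * b ^ 2 := by
          gcongr
        rw [rpow_sub_one_mul_sq hp hb0] at this
        linarith
      · have : a ^ (p - 1) * b ^ 2 ≤ a ^ (p - 1) * a ^ 2 := by gcongr
        rw [rpow_sub_one_mul_sq hp ha0] at this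
        linarith
    rw [hgb, hgb']
    nlinarith [sq_nonneg M]
  have hif := integrable_abs_rpow hp hf
  have hig := integrable_abs_rpow hp hg
  refine (integral_mono (integrable_abs_rpow_mul_sq hp hf hg)
    ((hif.add (hig.const_mul _)).const_mul _) hpt).trans ?_
  rw [integral_const_mul]
  simp only [Pi.add_apply]
  rw [integral_add hif (hig.const_mul _), integral_const_mul]
  have h1 : (M ^ (p + 1))⁻¹ * ∫ x, |g x| ^ (p + 1) ∂μ ≤ 1 := by
    rw [inv_mul_le_iff₀ hMp]; linarith
  nlinarith [sq_nonneg M]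

theorem hasDerivAt_integral_abs_add_rpow (hp : 1 < p) (hf : MemLp f (ENNReal.ofReal (p + 1)) μ)
    (hg : MemLp g (ENNReal.ofReal (p + 1)) μ) (t₀ : ℝ) :
    HasDerivAt (fun t : ℝ => ∫ x, |f x + t * g x| ^ (p + 1) ∂μ)
      ((p + 1) * ∫ x, |f x + t₀ * g x| ^ (p - 1) * (f x + t₀ * g x) * g x ∂μ) t₀ := by
  have hmem : ∀ t : ℝ, MemLp (fun x => f x + t * g x) (ENNReal.ofReal (p + 1)) μ :=
    fun t => hf.add (hg.const_mul t)
  have h := hasDerivAt_integral_of_dominated_loc_of_deriv_le (μ := μ) (𝕜 := ℝ) (x₀ := t₀)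
    (F := fun t x => |f x + t * g x| ^ (p + 1))
    (F' := fun t x => (p + 1) * (|f x + t * g x| ^ (p - 1) * (f x + t * g x) * g x))
    (bound := fun x => (p + 1) * |(|f x| + (|t₀| + 1) * |g x|)| ^ (p + 1))
    (Metric.ball_mem_nhds t₀ one_pos)
    (Filter.Eventually.of_forall fun t => (integrable_abs_rpow hp (hmem t)).1)
    (integrable_abs_rpow hp (hmem t₀))
    (((integrable_abs_rpow_mul_mul hp (hmem t₀) hg).const_mul _).1) ?_
    ((integrable_abs_add_rpow hp hf hg _).const_mul _) ?_
  · rw [← integral_const_mul]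
    exact h.2
  · refine ae_of_all _ fun x t ht => ?_
    have ht' : |t| ≤ |t₀| + 1 := by
      have h1 : |t - t₀| < 1 := by simpa [Real.dist_eq] using ht
      have := abs_sub_abs_le_abs_sub t t₀
      linarith
    have hf0 := abs_nonneg (f x)
    have hg0 := abs_nonneg (g x)
    have ht0 := abs_nonneg t₀
    have hle : |f x + t * g x| ≤ |f x| + (|t₀| + 1) * |g x| := by
      refine (abs_add_le _ _).trans ?_
      rw [abs_mul]; gcongr
    have hle' : |g x| ≤ |f x| + (|t₀| + 1) * |g x| := by nlinarith
    rw [abs_of_nonneg (by positivity : 0 ≤ |f x| + (|t₀| + 1) * |g x|),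
      ← rpow_sub_one_mul_sq hp (by positivity), pow_two, norm_mul, norm_mul, norm_mul,
      Real.norm_of_nonneg (by linarith : 0 ≤ p + 1),
      Real.norm_of_nonneg (by positivity : 0 ≤ |f x + t * g x| ^ (p - 1)), Real.norm_eq_abs,
      Real.norm_eq_abs, mul_assoc (|f x + t * g x| ^ (p - 1))]
    gcongr
  · refine ae_of_all _ fun x t _ => ?_
    have h1 : HasDerivAt (fun t : ℝ => f x + t * g x) (g x) t := by
      simpa using ((hasDerivAt_id t).mul_const (g x)).const_add (f x)
    refine ((hasDerivAt_abs_rpow_add_one hp (f x + t * g x)).comp t h1).congr_deriv ?_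
    ring

theorem hasDerivAt_integral_abs_add_rpow_mul (hp : 1 < p)
    (hf : MemLp f (ENNReal.ofReal (p + 1)) μ) (hg : MemLp g (ENNReal.ofReal (p + 1)) μ) (t₀ : ℝ) :
    HasDerivAt (fun t : ℝ => ∫ x, |f x + t * g x| ^ (p - 1) * (f x + t * g x) * g x ∂μ)
      (p * ∫ x, |f x + t₀ * g x| ^ (p - 1) * g x ^ 2 ∂μ) t₀ := by
  have hmem : ∀ t : ℝ, MemLp (fun x => f x + t * g x) (ENNReal.ofReal (p + 1)) μ :=
    fun t => hf.add (hg.const_mul t)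
  have h := hasDerivAt_integral_of_dominated_loc_of_deriv_le (μ := μ) (𝕜 := ℝ) (x₀ := t₀)
    (F := fun t x => |f x + t * g x| ^ (p - 1) * (f x + t * g x) * g x)
    (F' := fun t x => p * (|f x + t * g x| ^ (p - 1) * g x ^ 2))
    (bound := fun x => p * |(|f x| + (|t₀| + 1) * |g x|)| ^ (p + 1))
    (Metric.ball_mem_nhds t₀ one_pos)
    (Filter.Eventually.of_forall fun t => (integrable_abs_rpow_mul_mul hp (hmem t) hg).1)
    (integrable_abs_rpow_mul_mul hp (hmem t₀) hg)
    (((integrable_abs_rpow_mul_sq hp (hmem t₀) hg).const_mul _).1) ?_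
    ((integrable_abs_add_rpow hp hf hg _).const_mul _) ?_
  · rw [← integral_const_mul]
    exact h.2
  · refine ae_of_all _ fun x t ht => ?_
    have ht' : |t| ≤ |t₀| + 1 := by
      have h1 : |t - t₀| < 1 := by simpa [Real.dist_eq] using ht
      have := abs_sub_abs_le_abs_sub t t₀
      linarith
    have hf0 := abs_nonneg (f x)
    have hg0 := abs_nonneg (g x)
    have ht0 := abs_nonneg t₀
    have hle : |f x + t * g x| ≤ |f x| + (|t₀| + 1) * |g x| := by
      refine (abs_add_le _ _).trans ?_
      rw [abs_mul]; gcongr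
    have hle' : |g x| ≤ |f x| + (|t₀| + 1) * |g x| := by nlinarith
    rw [abs_of_nonneg (by positivity : 0 ≤ |f x| + (|t₀| + 1) * |g x|),
      ← rpow_sub_one_mul_sq hp (by positivity), Real.norm_of_nonneg (by positivity), ← sq_abs (g x)]
    gcongr
  · refine ae_of_all _ fun x t _ => ?_
    have h1 : HasDerivAt (fun t : ℝ => f x + t * g x) (g x) t := by
      simpa using ((hasDerivAt_id t).mul_const (g x)).const_add (f x)
    refine (((hasDerivAt_abs_rpow_mul_self hp (f x + t * g x)).comp t h1).mul_const
      (g x)).congr_deriv ?_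
    ring

end Integrals

/-! ### The quadratic form `Q`: expansion, boundedness and positivity. -/

section Energy

variable {d : ℕ} {Ω : Set (EuclideanSpace ℝ (Fin d))} {V : EuclideanSpace ℝ (Fin d) → ℝ}
  {ω p : ℝ}

/-- The symmetric bilinear form with `Q(u) = B(u, u)`. -/
def bilinQ (V : EuclideanSpace ℝ (Fin d) → ℝ) (ω : ℝ) (u v : H1 Ω) : ℝ :=
  1 / 2 * inner ℝ (grad u) (grad v) + ∫ x in Ω, (V x + ω) * fn u x * fn v x

theorem fn_add_smul (u v : H1 Ω) (t : ℝ) : fn (u + t • v) = fn u + t • fn v := rfl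

theorem grad_add_smul (u v : H1 Ω) (t : ℝ) : grad (u + t • v) = grad u + t • grad v := rfl

theorem fn_smul (t : ℝ) (u : H1 Ω) : fn (t • u) = t • fn u := rfl

theorem coeFn_fn_add_smul (u v : H1 Ω) (t : ℝ) :
    fn (u + t • v) =ᵐ[leb Ω] fun x => fn u x + t * fn v x := by
  rw [fn_add_smul]
  filter_upwards [Lp.coeFn_add (fn u) (t • fn v), Lp.coeFn_smul t (fn v)] with x h1 h2
  rw [h1, Pi.add_apply, h2]; rfl

theorem integrable_fn_mul_fn (u v : H1 Ω) : Integrable (fun x => fn u x * fn v x) (leb Ω) :=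
  (Lp.memLp (fn u)).integrable_mul (Lp.memLp (fn v))

theorem integrable_potential_mul (hV : MemLp V ⊤ (leb Ω)) (u v : H1 Ω) :
    Integrable (fun x => V x * (fn u x * fn v x)) (leb Ω) := by
  have h : Integrable (V * fun x => fn u x * fn v x) (leb Ω) :=
    hV.integrable_mul (memLp_one_iff_integrable.2 (integrable_fn_mul_fn u v))
  exact h

theorem integrable_shifted_mul (hV : MemLp V ⊤ (leb Ω)) (u v : H1 Ω) :
    Integrable (fun x => (V x + ω) * fn u x * fn v x) (leb Ω) := by
  refine ((integrable_potential_mul hV u v).add ((integrable_fn_mul_fn u v).const_mul ω)).congr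
    (ae_of_all _ fun x => ?_)
  simp only [Pi.add_apply]; ring

theorem norm_fn_sq (u : H1 Ω) : ‖fn u‖ ^ 2 = ∫ x in Ω, fn u x * fn u x := by
  rw [← real_inner_self_eq_norm_sq, L2.inner_def]
  rfl

theorem Q_eq_bilinQ (hV : MemLp V ⊤ (leb Ω)) (u : H1 Ω) : Q V ω u = bilinQ V ω u u := by
  rw [Q, bilinQ, real_inner_self_eq_norm_sq, norm_fn_sq, add_assoc, ← integral_const_mul]
  congr 1
  have h : ∀ x, V x * |fn u x| ^ 2 = V x * (fn u x * fn u x) := fun x => by rw [sq_abs, pow_two]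
  simp only [h]
  rw [← integral_add (integrable_potential_mul hV u u) ((integrable_fn_mul_fn u u).const_mul ω)]
  congr 1; ext x; ring

/-- This exact expansion serves both the Gâteaux derivatives of the Lagrangian and the comparison of
`Q(u)` with `Q(u_g)`. -/
theorem Q_add_smul (hV : MemLp V ⊤ (leb Ω)) (u v : H1 Ω) (t : ℝ) :
    Q V ω (u + t • v) = Q V ω u + 2 * t * bilinQ V ω u v + t ^ 2 * Q V ω v := by
  simp only [Q_eq_bilinQ hV, bilinQ, grad_add_smul]
  have h1 : ∫ x in Ω, (V x + ω) * fn (u + t • v) x * fn (u + t • v) x =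
      (∫ x in Ω, (V x + ω) * fn u x * fn u x) + (2 * t) * (∫ x in Ω, (V x + ω) * fn u x * fn v x)
        + t ^ 2 * (∫ x in Ω, (V x + ω) * fn v x * fn v x) := by
    have i1 := integrable_shifted_mul (ω := ω) hV u u
    have i2 := (integrable_shifted_mul (ω := ω) hV u v).const_mul (2 * t)
    have i3 := (integrable_shifted_mul (ω := ω) hV v v).const_mul (t ^ 2)
    rw [← integral_const_mul, ← integral_const_mul, ← integral_add' i1 i2,
      ← integral_add' (i1.add i2) i3]
    refine integral_congr_ae ?_
    filter_upwards [coeFn_fn_add_smul u v t] with x hx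
    simp only [hx, Pi.add_apply]; ring
  rw [h1, inner_add_left, inner_add_right, inner_add_right, inner_smul_left, inner_smul_right,
    inner_smul_left, inner_smul_right, real_inner_comm (grad v) (grad u)]
  simp only [conj_trivial]
  ring

theorem Q_smul (hV : MemLp V ⊤ (leb Ω)) (u : H1 Ω) (t : ℝ) :
    Q V ω (t • u) = t ^ 2 * Q V ω u := by
  have h0 : Q V ω (0 : H1 Ω) = 0 := by
    have h := Q_add_smul (ω := ω) hV (0 : H1 Ω) 0 1
    have h' := Q_add_smul (ω := ω) hV (0 : H1 Ω) 0 (-1)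
    simp only [smul_zero, add_zero] at h h'
    linarith
  have hb : bilinQ V ω 0 u = 0 := by
    have h := Q_add_smul (ω := ω) hV u u (-1)
    have h1 := Q_add_smul (ω := ω) hV 0 u 1
    rw [zero_add, one_smul, h0] at h1
    linarith
  have h := Q_add_smul (ω := ω) hV 0 u t
  rw [zero_add, h0, hb] at h
  linarith

theorem exists_Q_le (hV : MemLp V ⊤ (leb Ω)) (ω : ℝ) :
    ∃ C > 0, ∀ u : H1 Ω, Q V ω u ≤ C * ‖u‖ ^ 2 := by
  obtain ⟨M, hM⟩ : ∃ M : ℝ, ∀ᵐ x ∂(leb Ω), ‖V x‖ ≤ M := by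
    refine ⟨(eLpNormEssSup V (leb Ω)).toReal, ?_⟩
    have hfin : eLpNormEssSup V (leb Ω) ≠ ⊤ := by
      have := hV.2.ne
      rwa [eLpNorm_exponent_top] at this
    filter_upwards [enorm_ae_le_eLpNormEssSup V (leb Ω)] with x hx
    rw [← toReal_enorm]
    exact ENNReal.toReal_mono hfin hx
  refine ⟨1 / 2 + |M| + |ω|, by positivity, fun u => ?_⟩
  have h1 : ∫ x in Ω, V x * |fn u x| ^ 2 ≤ |M| * ‖fn u‖ ^ 2 := by
    rw [norm_fn_sq, ← integral_const_mul]
    refine integral_mono_ae ?_ ((integrable_fn_mul_fn u u).const_mul _) ?_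
    · refine (integrable_potential_mul hV u u).congr (ae_of_all _ fun x => ?_)
      simp only [sq_abs, pow_two (fn u x)]
    · filter_upwards [hM] with x hx
      rw [sq_abs, pow_two]
      exact mul_le_mul_of_nonneg_right ((le_abs_self _).trans (hx.trans (le_abs_self M)))
        (mul_self_nonneg _)
  have h2 : ω * ‖fn u‖ ^ 2 ≤ |ω| * ‖fn u‖ ^ 2 := by gcongr; exact le_abs_self ω
  rw [Q, norm_sq_eq]
  have := sq_nonneg ‖fn u‖
  have := sq_nonneg ‖grad u‖
  nlinarith [abs_nonneg M, abs_nonneg ω, mul_nonneg (abs_nonneg M) (sq_nonneg ‖grad u‖),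
    mul_nonneg (abs_nonneg ω) (sq_nonneg ‖grad u‖)]

/-- The frequency condition `ω > -λ₀` makes `Q` positive on nonzero elements of `X`. -/
theorem Q_pos {X : Submodule ℝ (H1 Ω)} (hV : MemLp V ⊤ (leb Ω))
    (hV0 : ∀ᵐ x ∂(leb Ω), 0 ≤ V x) (hω : -lambda0 X V < ω) {u : H1 Ω} (hu : u ∈ X)
    (hu0 : fn u ≠ 0) : 0 < Q V ω u := by
  have hn : 0 < ‖fn u‖ := norm_pos_iff.2 hu0
  set w : H1 Ω := ‖fn u‖⁻¹ • u with hw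
  have hw1 : ‖fn w‖ = 1 := by
    rw [hw, fn_smul, norm_smul, norm_inv, norm_norm, inv_mul_cancel₀ hn.ne']
  have hle : lambda0 X V ≤ 1 / 2 * ‖grad w‖ ^ 2 + ∫ x in Ω, V x * |fn w x| ^ 2 := by
    -- A real `sInf` is a lower bound only for sets bounded below; `V ≥ 0` supplies the bound `0`.
    refine csInf_le ⟨0, ?_⟩ ⟨w, X.smul_mem _ hu, hw1, rfl⟩
    rintro e ⟨v, -, -, rfl⟩
    have : 0 ≤ ∫ x in Ω, V x * |fn v x| ^ 2 := by
      refine integral_nonneg_of_ae ?_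
      filter_upwards [hV0] with x hx using mul_nonneg hx (sq_nonneg _)
    positivity
  have hQw : 0 < Q V ω w := by
    rw [Q, hw1]; linarith
  rw [hw, Q_smul hV] at hQw
  exact (mul_pos_iff_of_pos_left (by positivity)).1 hQw

end Energy

/-! ### The `L^(p+1)` constraint, the second variation and the embedding bound. -/

section Constraint

variable {d : ℕ} {Ω : Set (EuclideanSpace ℝ (Fin d))} {V : EuclideanSpace ℝ (Fin d) → ℝ}
  {ω p : ℝ}

theorem memLp_of_normLp1_lt_top {u : H1 Ω} (h : normLp1 p u < ⊤) :
    MemLp (fn u) (ENNReal.ofReal (p + 1)) (leb Ω) :=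
  ⟨Lp.aestronglyMeasurable _, h⟩

theorem toReal_normLp1_rpow (hp : 1 < p) {u : H1 Ω}
    (hu : MemLp (fn u) (ENNReal.ofReal (p + 1)) (leb Ω)) :
    (normLp1 p u).toReal ^ (p + 1) = ∫ x in Ω, |fn u x| ^ (p + 1) := by
  have h0 : 0 ≤ ∫ x in Ω, |fn u x| ^ (p + 1) := integral_nonneg fun x => by positivity
  rw [normLp1, hu.eLpNorm_eq_integral_rpow_norm (by simp; linarith) ENNReal.ofReal_ne_top,
    ENNReal.toReal_ofReal (by linarith : 0 ≤ p + 1)]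
  simp only [Real.norm_eq_abs]
  rw [ENNReal.toReal_ofReal (by positivity), ← Real.rpow_mul h0, inv_mul_cancel₀ (by linarith),
    Real.rpow_one]

theorem normLp1_eq_one (hp : 1 < p) {u : H1 Ω}
    (hu : MemLp (fn u) (ENNReal.ofReal (p + 1)) (leb Ω))
    (h : ∫ x in Ω, |fn u x| ^ (p + 1) = 1) : normLp1 p u = 1 := by
  rw [normLp1, hu.eLpNorm_eq_integral_rpow_norm (by simp; linarith) ENNReal.ofReal_ne_top,
    ENNReal.toReal_ofReal (by linarith : 0 ≤ p + 1)]
  simp only [Real.norm_eq_abs]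
  rw [h, Real.one_rpow, ENNReal.ofReal_one]

theorem memLp_fn_add_smul {u v : H1 Ω} (hu : MemLp (fn u) (ENNReal.ofReal (p + 1)) (leb Ω))
    (hv : MemLp (fn v) (ENNReal.ofReal (p + 1)) (leb Ω)) (t : ℝ) :
    MemLp (fn (u + t • v)) (ENNReal.ofReal (p + 1)) (leb Ω) :=
  (memLp_congr_ae (coeFn_fn_add_smul u v t)).2 (hu.add (hv.const_mul t))

theorem coeFn_fn_smul (u : H1 Ω) (t : ℝ) : fn (t • u) =ᵐ[leb Ω] fun x => t * fn u x := by
  rw [fn_smul]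
  exact Lp.coeFn_smul t (fn u)

theorem Lagrangian_add_smul (hp : 1 < p) (hV : MemLp V ⊤ (leb Ω)) {u v : H1 Ω}
    (hu : MemLp (fn u) (ENNReal.ofReal (p + 1)) (leb Ω))
    (hv : MemLp (fn v) (ENNReal.ofReal (p + 1)) (leb Ω)) (l t : ℝ) :
    Lagrangian V ω p l (u + t • v) = Q V ω u + 2 * t * bilinQ V ω u v + t ^ 2 * Q V ω v
      - l * (2 / (p + 1) * ((∫ x in Ω, |fn u x + t * fn v x| ^ (p + 1)) - 1)) := by
  rw [Lagrangian, Q_add_smul hV, G, toReal_normLp1_rpow hp (memLp_fn_add_smul hu hv t)]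
  congr 4
  refine integral_congr_ae ?_
  filter_upwards [coeFn_fn_add_smul u v t] with x hx
  rw [hx]

/-- The second Gâteaux derivative of the Lagrangian on the diagonal. -/
theorem gateaux2_Lagrangian (hp : 1 < p) (hV : MemLp V ⊤ (leb Ω)) {u v : H1 Ω}
    (hu : MemLp (fn u) (ENNReal.ofReal (p + 1)) (leb Ω))
    (hv : MemLp (fn v) (ENNReal.ofReal (p + 1)) (leb Ω)) (l : ℝ) :
    gateaux2 (Lagrangian V ω p l) u v v =
      2 * Q V ω v - 2 * l * p * ∫ x in Ω, |fn u x| ^ (p - 1) * fn v x ^ 2 := by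
  have hp1 : p + 1 ≠ 0 := by linarith
  have hfirst : ∀ s : ℝ, HasDerivAt (fun t => Lagrangian V ω p l (u + t • v))
      (2 * bilinQ V ω u v + 2 * s * Q V ω v
        - 2 * l * ∫ x in Ω, |fn u x + s * fn v x| ^ (p - 1) * (fn u x + s * fn v x) * fn v x)
      s := by
    intro s
    have h1 := (((((hasDerivAt_id s).const_mul 2).mul_const (bilinQ V ω u v)).const_add
      (Q V ω u)).add ((hasDerivAt_pow 2 s).mul_const (Q V ω v))).sub
      ((((hasDerivAt_integral_abs_add_rpow hp hu hv s).sub_const 1).const_mul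
        (2 / (p + 1))).const_mul l)
    refine (h1.congr_deriv ?_).congr_of_eventuallyEq
      (Filter.Eventually.of_forall fun t => Lagrangian_add_smul hp hV hu hv l t)
    field_simp
    push_cast
    ring
  have hgat : ∀ s : ℝ, gateaux (Lagrangian V ω p l) (u + s • v) v =
      2 * bilinQ V ω u v + 2 * s * Q V ω v
        - 2 * l * ∫ x in Ω, |fn u x + s * fn v x| ^ (p - 1) * (fn u x + s * fn v x) * fn v x := by
    intro s
    -- Base point and direction lie on one line, so the derivative at `u + s • v` is that of the
    -- one-variable function at `s`.
    have h2 := HasDerivAt.comp_const_add s 0 (by simpa using hfirst s)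
    rw [gateaux]
    refine Eq.trans ?_ h2.deriv
    congr 1
    ext t
    rw [add_smul, add_assoc]
  rw [gateaux2]
  simp only [hgat]
  have h3 := ((((hasDerivAt_id (0 : ℝ)).const_mul 2).mul_const (Q V ω v)).const_add
    (2 * bilinQ V ω u v)).sub
    ((hasDerivAt_integral_abs_add_rpow_mul hp hu hv 0).const_mul (2 * l))
  refine h3.deriv.trans ?_
  simp only [zero_mul, add_zero]
  ring

/-- On the `L^{p+1}` part of `X`, existence of a ground state with positive energy bounds the
`L^{p+1}` norm by the square root of `Q`. -/
theorem exists_integral_rpow_le {X : Submodule ℝ (H1 Ω)} (hp : 1 < p) (hV : MemLp V ⊤ (leb Ω))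
    {ug : H1 Ω} (hug : IsGroundState X V ω p ug) (hpos : 0 < Q V ω ug) :
    ∃ K > 0, ∀ w ∈ X, MemLp (fn w) (ENNReal.ofReal (p + 1)) (leb Ω) →
      ∫ x in Ω, |fn w x| ^ (p + 1) ≤ (K * ‖w‖) ^ (p + 1) := by
  obtain ⟨C, hC, hQC⟩ := exists_Q_le hV ω
  refine ⟨Real.sqrt (C / Q V ω ug), Real.sqrt_pos.2 (by positivity), fun w hw hwm => ?_⟩
  set P := ∫ x in Ω, |fn w x| ^ (p + 1) with hP
  have hP0 : 0 ≤ P := integral_nonneg fun x => by positivity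
  rcases hP0.eq_or_lt with h0 | hPpos
  · rw [← h0]; positivity
  set N := P ^ (p + 1)⁻¹ with hN
  have hNpos : 0 < N := by positivity
  have hNP : N ^ (p + 1) = P := Real.rpow_inv_rpow hP0 (by linarith)
  have hmem : MemLp (fn (N⁻¹ • w)) (ENNReal.ofReal (p + 1)) (leb Ω) :=
    (memLp_congr_ae (coeFn_fn_smul w N⁻¹)).2 (hwm.const_mul _)
  have hone : ∫ x in Ω, |fn (N⁻¹ • w) x| ^ (p + 1) = 1 := by
    have : ∫ x in Ω, |fn (N⁻¹ • w) x| ^ (p + 1) =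
        ∫ x in Ω, (N⁻¹) ^ (p + 1) * |fn w x| ^ (p + 1) := by
      refine integral_congr_ae ?_
      filter_upwards [coeFn_fn_smul w N⁻¹] with x hx
      rw [hx, abs_mul, Real.mul_rpow (abs_nonneg _) (abs_nonneg _), abs_of_pos (inv_pos.2 hNpos)]
    rw [this, integral_const_mul, Real.inv_rpow hNpos.le, hNP, ← hP, inv_mul_cancel₀ hPpos.ne']
  -- The normalised `w` competes with `ug`, and degree-two homogeneity turns minimality into `N²
  -- Q(ug) ≤ Q(w)`.
  have hmin : Q V ω ug ≤ Q V ω (N⁻¹ • w) :=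
    hug.2 ⟨X.smul_mem _ hw, normLp1_eq_one hp hmem hone⟩
  rw [Q_smul hV] at hmin
  have h2 : N ^ 2 ≤ C / Q V ω ug * ‖w‖ ^ 2 := by
    rw [div_mul_eq_mul_div, le_div_iff₀ hpos]
    have h3 := mul_le_mul_of_nonneg_left hmin (sq_nonneg N)
    rw [← mul_assoc, inv_pow, mul_inv_cancel₀ (by positivity), one_mul] at h3
    exact h3.trans (hQC w)
  have h4 : N ≤ Real.sqrt (C / Q V ω ug) * ‖w‖ := by
    refine le_of_sq_le_sq ?_ (by positivity)
    rwa [mul_pow, Real.sq_sqrt (by positivity)]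
  rw [← hNP]
  exact Real.rpow_le_rpow hNpos.le h4 (by linarith)

end Constraint

/-! ### Integrated first- and second-order bounds for `∫ |f + g|^(p+1)`. -/

section Expansion

variable {α : Type*} [MeasurableSpace α] {μ : Measure α} {p : ℝ} {f g : α → ℝ}

theorem le_integral_abs_add_rpow (hp : 1 < p) (hf : MemLp f (ENNReal.ofReal (p + 1)) μ)
    (hg : MemLp g (ENNReal.ofReal (p + 1)) μ) :
    ∫ x, |f x| ^ (p + 1) ∂μ + (p + 1) * ∫ x, |f x| ^ (p - 1) * f x * g x ∂μ ≤
      ∫ x, |f x + g x| ^ (p + 1) ∂μ := by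
  have i1 := integrable_abs_rpow hp hf
  have i2 := (integrable_abs_rpow_mul_mul hp hf hg).const_mul (p + 1)
  rw [← integral_const_mul, ← integral_add i1 i2]
  exact integral_mono (i1.add i2) (integrable_abs_rpow hp (hf.add hg))
    fun x => abs_rpow_add_ge hp (f x) (g x)

theorem integral_abs_add_rpow_le (hp : 1 < p) {ε C : ℝ}
    (h : ∀ a b : ℝ, |a + b| ^ (p + 1) ≤
      |a| ^ (p + 1) + (p + 1) * (|a| ^ (p - 1) * a * b)
        + ((p + 1) * p / 2 + ε) * (|a| ^ (p - 1) * b ^ 2) + C * |b| ^ (p + 1))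
    (hf : MemLp f (ENNReal.ofReal (p + 1)) μ) (hg : MemLp g (ENNReal.ofReal (p + 1)) μ) :
    ∫ x, |f x + g x| ^ (p + 1) ∂μ ≤
      ∫ x, |f x| ^ (p + 1) ∂μ + (p + 1) * ∫ x, |f x| ^ (p - 1) * f x * g x ∂μ
        + ((p + 1) * p / 2 + ε) * ∫ x, |f x| ^ (p - 1) * g x ^ 2 ∂μ
        + C * ∫ x, |g x| ^ (p + 1) ∂μ := by
  have i1 := integrable_abs_rpow hp hf
  have i2 := (integrable_abs_rpow_mul_mul hp hf hg).const_mul (p + 1)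
  have i3 := (integrable_abs_rpow_mul_sq hp hf hg).const_mul ((p + 1) * p / 2 + ε)
  have i4 := (integrable_abs_rpow hp hg).const_mul C
  rw [← integral_const_mul, ← integral_const_mul, ← integral_const_mul, ← integral_add' i1 i2,
    ← integral_add' (i1.add i2) i3, ← integral_add' ((i1.add i2).add i3) i4]
  exact integral_mono (integrable_abs_rpow hp (hf.add hg)) (((i1.add i2).add i3).add i4)
    fun x => h (f x) (g x)

end Expansion

/-! ### Coercivity around the ground state and the quadratic bounds. -/

section GroundState

variable {d : ℕ} {Ω : Set (EuclideanSpace ℝ (Fin d))} {V : EuclideanSpace ℝ (Fin d) → ℝ}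
  {ω p : ℝ} {X : Submodule ℝ (H1 Ω)}

theorem bilinQ_comm (u v : H1 Ω) : bilinQ V ω u v = bilinQ V ω v u := by
  rw [bilinQ, bilinQ, real_inner_comm]
  congr 2
  ext x; ring

theorem memLp_of_mem_sphere {u : H1 Ω} (hu : u ∈ sphere X p) :
    MemLp (fn u) (ENNReal.ofReal (p + 1)) (leb Ω) :=
  memLp_of_normLp1_lt_top (by rw [hu.2]; exact ENNReal.one_lt_top)

theorem integral_of_mem_sphere (hp : 1 < p) {u : H1 Ω} (hu : u ∈ sphere X p) :
    ∫ x in Ω, |fn u x| ^ (p + 1) = 1 := by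
  rw [← toReal_normLp1_rpow hp (memLp_of_mem_sphere hu), hu.2, ENNReal.toReal_one, Real.one_rpow]

theorem pairing_self (hp : 1 < p) {u : H1 Ω} (hu : u ∈ sphere X p) : pairing p u u = 1 := by
  refine Eq.trans ?_ (integral_of_mem_sphere hp hu)
  rw [pairing]
  congr 1
  ext x
  rw [← rpow_sub_one_mul_sq hp (abs_nonneg (fn u x)), sq_abs]
  ring

/-- Test the multiplier equation with `u` itself. -/
theorem IsMultiplier.eq_Q (hp : 1 < p) (hV : MemLp V ⊤ (leb Ω)) {u : H1 Ω}
    (hu : u ∈ sphere X p) {l : ℝ} (hl : IsMultiplier X V ω p u l) : l = Q V ω u := by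
  have h := hl u hu.1 (by rw [hu.2]; exact ENNReal.one_lt_top)
  rw [pairing_self hp hu, mul_one] at h
  rw [Q_eq_bilinQ hV, bilinQ, h]

theorem fn_ne_zero_of_mem_sphere (hp : 1 < p) {u : H1 Ω} (hu : u ∈ sphere X p) : fn u ≠ 0 := by
  intro h
  have h1 := integral_of_mem_sphere hp hu
  have h2 : ∫ x in Ω, |fn u x| ^ (p + 1) = 0 := by
    refine integral_eq_zero_of_ae ?_
    filter_upwards [(Lp.eq_zero_iff_ae_eq_zero).1 h] with x hx
    rw [hx]
    simp [Real.zero_rpow (by linarith : p + 1 ≠ 0)]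
  linarith

/-- Coercivity of the second variation on the tangent space, transported to an arbitrary
direction `h` through the splitting `h = ξ + a u` with `a = ⟨|u|^{p-1} u, h⟩`. -/
theorem le_Q_of_coercive (hp : 1 < p) (hV : MemLp V ⊤ (leb Ω)) {u : H1 Ω}
    (hu : u ∈ sphere X p) {l c : ℝ} (hl : IsMultiplier X V ω p u l) (hc : 0 < c)
    (hcoer : ∀ ξ ∈ tangent X p u, c * ‖ξ‖ ^ 2 ≤ gateaux2 (Lagrangian V ω p l) u ξ ξ)
    {h : H1 Ω} (hh : h ∈ X) (hm : MemLp (fn h) (ENNReal.ofReal (p + 1)) (leb Ω)) :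
    c / 4 * ‖h‖ ^ 2 + l * p * (∫ x in Ω, |fn u x| ^ (p - 1) * fn h x ^ 2)
      - (l * (p - 1) + c / 2 * ‖u‖ ^ 2) * pairing p u h ^ 2 ≤ Q V ω h := by
  have hum := memLp_of_mem_sphere hu
  set a := pairing p u h with ha
  set ξ : H1 Ω := h + (-a) • u with hξ
  have hξm : MemLp (fn ξ) (ENNReal.ofReal (p + 1)) (leb Ω) := memLp_fn_add_smul hm hum _
  have hcoe := coeFn_fn_add_smul h u (-a)
  have hp0 : pairing p u u = 1 := pairing_self hp hu
  have i1 := integrable_abs_rpow_mul_mul hp hum hm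
  have i2 := integrable_abs_rpow_mul_mul hp hum hum
  have i3 := integrable_abs_rpow_mul_sq hp hum hm
  have hpair : pairing p u ξ = 0 := by
    have : pairing p u ξ = pairing p u h + (-a) * pairing p u u := by
      rw [pairing, pairing, pairing, ← integral_const_mul, ← integral_add i1 (i2.const_mul _)]
      refine integral_congr_ae ?_
      filter_upwards [hcoe] with x hx
      rw [hx]; ring
    rw [this, hp0, ← ha]; ring
  have hsq : ∫ x in Ω, |fn u x| ^ (p - 1) * fn ξ x ^ 2 =
      (∫ x in Ω, |fn u x| ^ (p - 1) * fn h x ^ 2) - a ^ 2 := by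
    have : ∫ x in Ω, |fn u x| ^ (p - 1) * fn ξ x ^ 2 =
        (∫ x in Ω, |fn u x| ^ (p - 1) * fn h x ^ 2) + (-2 * a) * pairing p u h
          + a ^ 2 * pairing p u u := by
      rw [pairing, pairing, ← integral_const_mul, ← integral_const_mul,
        ← integral_add' i3 (i1.const_mul _), ← integral_add' (i3.add (i1.const_mul _))
          (i2.const_mul _)]
      refine integral_congr_ae ?_
      filter_upwards [hcoe] with x hx
      simp only [Pi.add_apply]
      rw [hx]; ring
    rw [this, hp0, ← ha]; ring
  have hbil : bilinQ V ω h u = l * a := by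
    rw [bilinQ_comm]
    exact hl h hh hm.2
  -- The cross term contributes `-2 l a²` and `a² Q(u) = l a²` restores half of it.
  have hQξ : Q V ω ξ = Q V ω h - l * a ^ 2 := by
    rw [hξ, Q_add_smul hV, hbil, ← hl.eq_Q hp hV hu]; ring
  have hco := hcoer ξ ⟨X.add_mem hh (X.smul_mem _ hu.1), hξm.2, by rw [hpair, mul_zero]⟩
  rw [gateaux2_Lagrangian hp hV hum hξm, hsq, hQξ] at hco
  have hnorm : ‖h‖ ^ 2 ≤ 2 * ‖ξ‖ ^ 2 + 2 * (a ^ 2 * ‖u‖ ^ 2) := by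
    have h1 : ‖h‖ ≤ ‖ξ‖ + |a| * ‖u‖ := by
      have h2 : h = ξ + a • u := by rw [hξ]; module
      calc ‖h‖ = ‖ξ + a • u‖ := by rw [← h2]
        _ ≤ ‖ξ‖ + ‖a • u‖ := norm_add_le _ _
        _ = ‖ξ‖ + |a| * ‖u‖ := by rw [norm_smul, Real.norm_eq_abs]
    have h3 : ‖h‖ ^ 2 ≤ (‖ξ‖ + |a| * ‖u‖) ^ 2 := by gcongr
    have h4 : (|a| * ‖u‖) ^ 2 = a ^ 2 * ‖u‖ ^ 2 := by rw [mul_pow, sq_abs]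
    nlinarith [sq_nonneg (‖ξ‖ - |a| * ‖u‖)]
  have h5 := mul_le_mul_of_nonneg_left hnorm hc.le
  linarith

/-- A radius making the quadratic and the `(p-1)`-power error terms small. -/
theorem exists_small_radius {p : ℝ} (hp : 1 < p) (E F : ℝ) {η : ℝ} (hη : 0 < η) :
    ∃ δ₀ : ℝ, 0 < δ₀ ∧ δ₀ ≤ 1 ∧ E * δ₀ ^ 2 ≤ η ∧ F * δ₀ ^ (p - 1) ≤ η := by
  have t1 : Filter.Tendsto (fun δ : ℝ => E * δ ^ 2) (nhdsWithin 0 (Set.Ioi 0)) (nhds 0) := by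
    have : Continuous fun δ : ℝ => E * δ ^ 2 := by fun_prop
    simpa using (this.tendsto 0).mono_left (nhdsWithin_le_nhds (s := Set.Ioi (0 : ℝ)))
  have t2 : Filter.Tendsto (fun δ : ℝ => F * δ ^ (p - 1)) (nhdsWithin 0 (Set.Ioi 0))
      (nhds 0) := by
    have : Continuous fun δ : ℝ => F * δ ^ (p - 1) :=
      continuous_const.mul (continuous_id.rpow_const fun _ => Or.inr (by linarith))
    have h := (this.tendsto 0).mono_left (nhdsWithin_le_nhds (s := Set.Ioi (0 : ℝ)))
    rwa [Real.zero_rpow (by linarith), mul_zero] at h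
  have t3 : ∀ᶠ δ : ℝ in nhdsWithin 0 (Set.Ioi 0), δ ≤ 1 :=
    (eventually_le_nhds one_pos).filter_mono nhdsWithin_le_nhds
  obtain ⟨δ, ⟨⟨h1, h2⟩, h3⟩, h4⟩ := (((t1.eventually_le_const hη).and
    (t2.eventually_le_const hη)).and t3 |>.and self_mem_nhdsWithin).exists
  exact ⟨δ, h4, h3, h1, h2⟩

/-- The error terms of the second order expansion are absorbed for small radii. -/
theorem second_order_lower_bound {p l c K C m r δ a A P : ℝ} (hp : 1 < p) (hl : 0 < l) (hc : 0 < c)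
    (hK : 0 < K) (hC : 0 < C) (hm : 0 ≤ m) (hr : 0 < r) (hδ : r ≤ δ) (hδ1 : δ ≤ 1) (ha : a ≤ 0)
    (hupp : 1 ≤ 1 + (p + 1) * a + ((p + 1) * p / 2 + c * (p + 1) / (64 * l * K ^ 2)) * A + C * P)
    (hA : A ≤ 2 * (K * r) ^ 2) (hP : P ≤ K ^ (p + 1) * (r ^ (p - 1) * r ^ 2))
    (hE : m * ((((p + 1) * p / 2 + c * (p + 1) / (64 * l * K ^ 2)) * (2 * K ^ 2)
      + C * K ^ (p + 1)) / (p + 1)) ^ 2 * δ ^ 2 ≤ c / 16)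
    (hF : 2 * l / (p + 1) * C * K ^ (p + 1) * δ ^ (p - 1) ≤ c / 16) :
    -(l * p * A) + m * a ^ 2 - 3 * (c / 16) * r ^ 2 ≤ 2 * l * a := by
  have hp1 : 0 < p + 1 := by linarith
  have hrδ : r ^ (p - 1) ≤ δ ^ (p - 1) := Real.rpow_le_rpow hr.le hδ (by linarith)
  have hr1 : r ^ (p - 1) ≤ 1 := Real.rpow_le_one hr.le (hδ.trans hδ1) (by linarith)
  set ε : ℝ := c * (p + 1) / (64 * l * K ^ 2) with hε
  have hεpos : 0 < ε := by positivity
  set D : ℝ := (((p + 1) * p / 2 + ε) * (2 * K ^ 2) + C * K ^ (p + 1)) / (p + 1) with hD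
  have hD0 : 0 ≤ D := by positivity
  -- With `a ≤ 0` this makes `a` quadratic in `r`, so that `a²` is of fourth order.
  have haD : -a ≤ D * r ^ 2 := by
    have h1 : ((p + 1) * p / 2 + ε) * A ≤ ((p + 1) * p / 2 + ε) * (2 * (K * r) ^ 2) := by gcongr
    have h2 : C * P ≤ C * (K ^ (p + 1) * (1 * r ^ 2)) := by
      gcongr; exact hP.trans (by gcongr)
    rw [hD, div_mul_eq_mul_div, le_div_iff₀ hp1]
    linarith
  have ha2 : m * a ^ 2 ≤ c / 16 * r ^ 2 := by
    have h1 : a ^ 2 ≤ D ^ 2 * δ ^ 2 * r ^ 2 := by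
      have h2 : (-a) ^ 2 ≤ (D * r ^ 2) ^ 2 := pow_le_pow_left₀ (by linarith) haD 2
      calc a ^ 2 = (-a) ^ 2 := by ring
        _ ≤ (D * r ^ 2) ^ 2 := h2
        _ = D ^ 2 * r ^ 2 * r ^ 2 := by ring
        _ ≤ D ^ 2 * δ ^ 2 * r ^ 2 := by gcongr
    calc m * a ^ 2
        ≤ m * (D ^ 2 * δ ^ 2 * r ^ 2) := by gcongr
      _ = m * D ^ 2 * δ ^ 2 * r ^ 2 := by ring
      _ ≤ c / 16 * r ^ 2 := by gcongr
  have hεA : 2 * l / (p + 1) * (ε * A) ≤ c / 16 * r ^ 2 := by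
    calc 2 * l / (p + 1) * (ε * A) ≤ 2 * l / (p + 1) * (ε * (2 * (K * r) ^ 2)) := by gcongr
      _ = c / 16 * r ^ 2 := by rw [hε]; field_simp; ring
  have hCP : 2 * l / (p + 1) * (C * P) ≤ c / 16 * r ^ 2 := by
    calc 2 * l / (p + 1) * (C * P)
        ≤ 2 * l / (p + 1) * (C * (K ^ (p + 1) * (δ ^ (p - 1) * r ^ 2))) := by
          gcongr; exact hP.trans (by gcongr)
      _ = 2 * l / (p + 1) * C * K ^ (p + 1) * δ ^ (p - 1) * r ^ 2 := by ring
      _ ≤ c / 16 * r ^ 2 := by gcongr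
  have h2la : -(l * p * A) - 2 * l / (p + 1) * (ε * A) - 2 * l / (p + 1) * (C * P)
      ≤ 2 * l * a := by
    have h1 : 0 ≤ (p + 1) * a + ((p + 1) * p / 2 + ε) * A + C * P := by linarith
    have h3 := mul_nonneg (show 0 ≤ 2 * l / (p + 1) by positivity) h1
    have h4 : 2 * l / (p + 1) * ((p + 1) * a + ((p + 1) * p / 2 + ε) * A + C * P) =
        2 * l * a + l * p * A + 2 * l / (p + 1) * (ε * A) + 2 * l / (p + 1) * (C * P) := by
      field_simp
      ring
    linarith
  linarith

/-- A locally quadratic two-sided bound for `Q - Q(u_g)` on the sphere. -/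
theorem exists_quadratic_bounds (hp : 1 < p) (hV : MemLp V ⊤ (leb Ω))
    (hV0 : ∀ᵐ x ∂(leb Ω), 0 ≤ V x) (hω : -lambda0 X V < ω) {ug : H1 Ω}
    (hug : IsGroundState X V ω p ug) {l c : ℝ} (hl : IsMultiplier X V ω p ug l) (hc : 0 < c)
    (hcoer : ∀ ξ ∈ tangent X p ug, c * ‖ξ‖ ^ 2 ≤ gateaux2 (Lagrangian V ω p l) ug ξ ξ) :
    ∃ δ₀ > 0, ∃ c₁ > 0, ∃ c₂ > 0, ∀ u ∈ sphere X p, ‖u - ug‖ ≤ δ₀ →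
      c₁ * ‖u - ug‖ ^ 2 ≤ Q V ω u - Q V ω ug ∧ Q V ω u - Q V ω ug ≤ c₂ * ‖u - ug‖ ^ 2 := by
  have hs := hug.1
  have hlQ : l = Q V ω ug := hl.eq_Q hp hV hs
  have hlpos : 0 < l := hlQ ▸ Q_pos hV hV0 hω hs.1 (fn_ne_zero_of_mem_sphere hp hs)
  obtain ⟨C, hC, hQC⟩ := exists_Q_le hV ω
  obtain ⟨K, hK, hemb⟩ := exists_integral_rpow_le hp hV hug (hlQ ▸ hlpos)
  have hum := memLp_of_mem_sphere hs
  have hone := integral_of_mem_sphere hp hs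
  -- Chosen so that `2l/(p+1) * ε * 2(Kr)²` equals `(c/16) r²`.
  set ε : ℝ := c * (p + 1) / (64 * l * K ^ 2) with hε
  have hp1 : 0 < p + 1 := by linarith
  have hεpos : 0 < ε := by positivity
  obtain ⟨Cε, hCε, htaylor⟩ := abs_add_rpow_le hp hεpos
  obtain ⟨δ₀, hδpos, hδ1, hδE, hδF⟩ := exists_small_radius hp
    ((l * (p - 1) + c / 2 * ‖ug‖ ^ 2) * ((((p + 1) * p / 2 + ε) * (2 * K ^ 2)
      + Cε * K ^ (p + 1)) / (p + 1)) ^ 2) (2 * l / (p + 1) * Cε * K ^ (p + 1))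
    (show 0 < c / 16 by positivity)
  -- Of the coercivity `c/4`, three error terms use `c/16` each; `c/16` is left.
  refine ⟨δ₀, hδpos, c / 16, by positivity, C, hC, fun u hu hδ => ?_⟩
  set h : H1 Ω := u - ug with hh
  have huh : u = ug + (1 : ℝ) • h := by rw [hh]; module
  have hhX : h ∈ X := X.sub_mem hu.1 hs.1
  have hhm : MemLp (fn h) (ENNReal.ofReal (p + 1)) (leb Ω) := by
    have : h = u + (-1 : ℝ) • ug := by rw [hh]; module
    rw [this]
    exact memLp_fn_add_smul (memLp_of_mem_sphere hu) hum _
  rcases eq_or_ne h 0 with h0 | h0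
  · have : u = ug := sub_eq_zero.1 h0
    rw [h0, this]; simp
  set r := ‖h‖ with hr
  have hrpos : 0 < r := norm_pos_iff.2 h0
  -- `h` need not be tangent to the sphere, so the linear term survives; the constraint shows it to
  -- be of second order.
  have hQ : Q V ω u - Q V ω ug = 2 * l * pairing p ug h + Q V ω h := by
    have hb : bilinQ V ω ug h = l * pairing p ug h := hl h hhX hhm.2
    rw [huh, Q_add_smul hV, hb]; ring
  have hconstr : ∫ x in Ω, |fn ug x + fn h x| ^ (p + 1) = 1 := by
    refine Eq.trans (integral_congr_ae ?_) (integral_of_mem_sphere hp hu)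
    have hcoe := coeFn_fn_add_smul ug h 1
    rw [← huh] at hcoe
    filter_upwards [hcoe] with x hx
    rw [hx, one_mul]
  have hlow := le_integral_abs_add_rpow hp hum hhm
  have hupp := integral_abs_add_rpow_le hp htaylor hum hhm
  have hmain := le_Q_of_coercive hp hV hs hl hc hcoer hhX hhm
  have hPn := hemb h hhX hhm
  have hA := integral_abs_rpow_mul_sq_le hp hum hhm hone.le (M := K * r) (by positivity) hPn
  rw [Real.mul_rpow hK.le hrpos.le, ← rpow_sub_one_mul_sq hp hrpos.le] at hPn
  rw [hconstr, hone] at hlow hupp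
  change 1 + (p + 1) * pairing p ug h ≤ 1 at hlow
  change 1 ≤ 1 + (p + 1) * pairing p ug h + _ + _ at hupp
  set a := pairing p ug h
  set A := ∫ x in Ω, |fn ug x| ^ (p - 1) * fn h x ^ 2
  set P := ∫ x in Ω, |fn h x| ^ (p + 1)
  have ha : a ≤ 0 := by
    by_contra hcon
    have := mul_pos hp1 (not_le.1 hcon)
    linarith
  have hcoef : 0 ≤ l * (p - 1) + c / 2 * ‖ug‖ ^ 2 := by
    have : 0 < p - 1 := by linarith
    positivity
  have hge := second_order_lower_bound hp hlpos hc hK hCε hcoef hrpos hδ hδ1 ha hupp hA hPn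
    hδE hδF
  rw [hQ]
  refine ⟨by linarith, ?_⟩
  have h1 : 2 * l * a ≤ 0 := mul_nonpos_of_nonneg_of_nonpos (by positivity) ha
  have h2 := hQC h
  linarith

end GroundState

end ActionGS

end

theorem proposition3p3 {d : ℕ} (hd : 1 ≤ d)
    (Ω : Set (EuclideanSpace ℝ (Fin d))) (hΩ : IsOpen Ω) (hΩc : IsConnected Ω)
    (hΩb : Bornology.IsBounded Ω)
    (X : Submodule ℝ (ActionGS.H1 Ω)) (hX : IsClosed (X : Set (ActionGS.H1 Ω)))
    (p : ℝ) (hp : 1 < p) (hpd : 3 ≤ d → p < ((d : ℝ) + 2) / ((d : ℝ) - 2))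
    (V : EuclideanSpace ℝ (Fin d) → ℝ) (hV : MemLp V ⊤ (volume.restrict Ω))
    (hV0 : ∀ᵐ x ∂(volume.restrict Ω), 0 ≤ V x)
    (ω : ℝ) (hω : -ActionGS.lambda0 X V < ω)
    (ug : ActionGS.H1 Ω) (hug : ActionGS.IsGroundState X V ω p ug)
    (lg : ℝ) (hlg : ActionGS.IsMultiplier X V ω p ug lg)
    (c : ℝ) (hc : 0 < c)
    (hcoer : ∀ ξ ∈ ActionGS.tangent X p ug,
      c * ‖ξ‖ ^ 2 ≤ ActionGS.gateaux2 (ActionGS.Lagrangian V ω p lg) ug ξ ξ) :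
    ∃ δ₀ > 0, ∃ c₁ > 0, ∃ c₂ > 0, ∀ δ : ℝ, 0 < δ → δ ≤ δ₀ →
      (∀ u ∈ ActionGS.nbhd X ug δ ∩ ActionGS.sphere X p,
        c₁ * ‖u - ug‖ ^ 2 ≤ ActionGS.Q V ω u - ActionGS.Q V ω ug ∧
        ActionGS.Q V ω u - ActionGS.Q V ω ug ≤ c₂ * ‖u - ug‖ ^ 2) ∧
      {u | u ∈ ActionGS.nbhd X ug δ ∩ ActionGS.sphere X p ∧
        IsMinOn (ActionGS.Q V ω) (ActionGS.nbhd X ug δ ∩ ActionGS.sphere X p) u} = {ug} ∧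
      {u | u ∈ ActionGS.nbhd X ug δ ∩ ActionGS.sphere X p ∧
        ActionGS.IsGroundState X V ω p u} = {ug} := by
  obtain ⟨δ₀, hδ₀, c₁, hc₁, c₂, hc₂, hbounds⟩ :=
    ActionGS.exists_quadratic_bounds hp hV hV0 hω hug hlg hc hcoer
  refine ⟨δ₀, hδ₀, c₁, hc₁, c₂, hc₂, fun δ hδ hδδ₀ => ?_⟩
  have hmem : ug ∈ ActionGS.nbhd X ug δ ∩ ActionGS.sphere X p :=
    ⟨⟨hug.1.1, by simpa using hδ.le⟩, hug.1⟩
  have hquad : ∀ u ∈ ActionGS.nbhd X ug δ ∩ ActionGS.sphere X p,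
      c₁ * ‖u - ug‖ ^ 2 ≤ ActionGS.Q V ω u - ActionGS.Q V ω ug ∧
      ActionGS.Q V ω u - ActionGS.Q V ω ug ≤ c₂ * ‖u - ug‖ ^ 2 :=
    fun u hu => hbounds u hu.2 (hu.1.2.trans hδδ₀)
  -- Local and global minimizers in the neighbourhood both satisfy `Q(u) ≤ Q(ug)`, so one argument
  -- covers both.
  have huniq : ∀ u ∈ ActionGS.nbhd X ug δ ∩ ActionGS.sphere X p,
      ActionGS.Q V ω u ≤ ActionGS.Q V ω ug → u = ug := by
    intro u hu hle
    have h1 : c₁ * ‖u - ug‖ ^ 2 ≤ 0 := (hquad u hu).1.trans (by linarith)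
    have h2 : ‖u - ug‖ ^ 2 ≤ 0 := nonpos_of_mul_nonpos_right h1 hc₁
    have h3 : ‖u - ug‖ = 0 := pow_eq_zero_iff two_ne_zero |>.1 (le_antisymm h2 (sq_nonneg _))
    exact sub_eq_zero.1 (norm_eq_zero.1 h3)
  refine ⟨hquad, Set.eq_singleton_iff_unique_mem.2 ⟨⟨hmem, ?_⟩, ?_⟩,
    Set.eq_singleton_iff_unique_mem.2 ⟨⟨hmem, hug⟩, ?_⟩⟩
  · exact fun u hu => hug.2 hu.2
  · exact fun u hu => huniq u hu.1 (hu.2 hmem)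
  · exact fun u hu => huniq u hu.1 (hu.2.2 hug.1)
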